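/- All vector spaces are over $\mathbb{Q}$. For a graded vector space $W=\bigoplus_{k\ge 1}W^k$ let $\Lambda W$ be the free commutative graded algebra on $W$. A Sullivan algebra is a commutative differential graded algebra $(\Lambda W,d)$, where $W=\bigoplus_{k\ge1}W^k$ is finite-dimensional in each degree and is the union of an increasing sequence of graded subspaces $F_0\subseteq F_1\subseteq\cdots$ with $d=0$ on $F_0$ and $d(F_{k+1})\subseteq\Lambda F_k$. It is called degree-filtered if in addition $W^1=0$ and $d(W^r)\subseteq\Lambda(W^{<r})$ for all $r$. It is elliptic if both $W$ and $H^*(\Lambda W,d)$ are finite-dimensional. An elliptic Sullivan algebra has formal dimension $N$ if $H^N$ is one-dimensional and $H^k=0$ for $k>N$; a fundamental class is then a generator of $H^N$. **Proposition.** Let $n\ge 1$, let $\mathcal{M}=(\Lambda W,d)$ be an elliptic Sullivan algebra of formal dimension $2n$, and let $x\in\mathcal{M}^{2n}$ be a cocycle representing a fundamental class in $H^{2n}(\mathcal{M})$. Then: 1. There is a unique differential $\tilde d$ on $\Lambda(W\oplus\mathbb{Q}y)=\Lambda W\otimes\Lambda(y)$, $\deg y=2n-1$, with $\tilde d|_W=d$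 and $\tilde d(y)=x$. Put $\widetilde{\mathcal{M}}=(\Lambda W\otimes\Lambda(y),\tilde d)$. 2. $\widetilde{\mathcal{M}}$ is an elliptic Sullivan algebra of formal dimension $4n-1$. If $\mathcal{M}$ is degree-filtered and $x\in\Lambda(W^{<2n-1})$, then $\widetilde{\mathcal{M}}$ is degree-filtered too. 3. If $H^*(\mathcal{M})$ is a Poincaré duality algebra of formal dimension $2n$ (that is, moreover the products $H^i\times H^{2n-i}\to H^{2n}$ are nondegenerate), then $H^*(\widetilde{\mathcal{M}})$ is a Poincaré duality algebra of formal dimension $4n-1$. 4. There is $z\in\mathcal{M}^{4n-1}$ with $d(z)=x^2$, and for every such $z$ the element $xy-z$ is a cocycle representing a fundamental class in $H^{4n-1}(\widetilde{\mathcal{M}})$. -/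

import Mathlib

open scoped DirectSum

namespace SullivanModel

universe u

/-! ### The free commutative graded algebra on a graded rational vector space -/

/-- The relations of graded commutativity `a b = (-1) ^ (i j) b a` for `a`, `b` homogeneous of
degrees `i`, `j`. Over `ℚ` they force the squares of odd elements to vanish. -/
inductive CommRel {W : Type u} [AddCommGroup W] [Module ℚ W] (𝒲 : ℕ → Submodule ℚ W) :
    TensorAlgebra ℚ W → TensorAlgebra ℚ W → Prop
  | comm (i j : ℕ) (a b : W) (ha : a ∈ 𝒲 i) (hb : b ∈ 𝒲 j) :
      CommRel 𝒲 (TensorAlgebra.ι ℚ a * TensorAlgebra.ι ℚ b)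
        ((-1) ^ (i * j) * (TensorAlgebra.ι ℚ b * TensorAlgebra.ι ℚ a))

/-- The congruence on the tensor algebra generated by graded commutativity. -/
def commCon {W : Type u} [AddCommGroup W] [Module ℚ W] (𝒲 : ℕ → Submodule ℚ W) :
    RingCon (TensorAlgebra ℚ W) :=
  ringConGen (CommRel 𝒲)

/-- `ΛW`, the free commutative graded algebra on the graded vector space `W = ⨁ k, 𝒲 k`. -/
def FreeCGA {W : Type u} [AddCommGroup W] [Module ℚ W] (𝒲 : ℕ → Submodule ℚ W) : Type u :=
  (commCon 𝒲).Quotient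

noncomputable instance {W : Type u} [AddCommGroup W] [Module ℚ W] (𝒲 : ℕ → Submodule ℚ W) :
    Ring (FreeCGA 𝒲) :=
  inferInstanceAs (Ring (commCon 𝒲).Quotient)

noncomputable instance {W : Type u} [AddCommGroup W] [Module ℚ W] (𝒲 : ℕ → Submodule ℚ W) :
    Algebra ℚ (FreeCGA 𝒲) :=
  inferInstanceAs (Algebra ℚ (commCon 𝒲).Quotient)

/-- The quotient map from the tensor algebra of `W` onto `ΛW`. -/
noncomputable def mk {W : Type u} [AddCommGroup W] [Module ℚ W] (𝒲 : ℕ → Submodule ℚ W) :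
    TensorAlgebra ℚ W →ₐ[ℚ] FreeCGA 𝒲 :=
  (commCon 𝒲).mkₐ ℚ

/-- The inclusion `W → ΛW` of the generators. -/
noncomputable def gen {W : Type u} [AddCommGroup W] [Module ℚ W] (𝒲 : ℕ → Submodule ℚ W) :
    W →ₗ[ℚ] FreeCGA 𝒲 :=
  (mk 𝒲).toLinearMap ∘ₗ TensorAlgebra.ι ℚ

theorem gen_mul_gen {W : Type u} [AddCommGroup W] [Module ℚ W] (𝒲 : ℕ → Submodule ℚ W)
    {i j : ℕ} {a b : W} (ha : a ∈ 𝒲 i) (hb : b ∈ 𝒲 j) :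
    gen 𝒲 a * gen 𝒲 b = (-1) ^ (i * j) * (gen 𝒲 b * gen 𝒲 a) := by
  have h : mk 𝒲 (TensorAlgebra.ι ℚ a * TensorAlgebra.ι ℚ b) =
      mk 𝒲 ((-1) ^ (i * j) * (TensorAlgebra.ι ℚ b * TensorAlgebra.ι ℚ a)) :=
    Quotient.sound (RingCon.le_ringConGen _ _ (CommRel.comm i j a b ha hb))
  simp only [map_mul, map_pow, map_neg, map_one] at h
  exact h

/-- The universal property of `ΛW`: a linear map from `W` to an algebra whose values commute in
the graded sense extends to `ΛW`. -/
noncomputable def lift {W : Type u} [AddCommGroup W] [Module ℚ W] (𝒲 : ℕ → Submodule ℚ W)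
    {A : Type*} [Ring A] [Algebra ℚ A] (f : W →ₗ[ℚ] A)
    (hf : ∀ i j, ∀ a ∈ 𝒲 i, ∀ b ∈ 𝒲 j, f a * f b = (-1) ^ (i * j) * (f b * f a)) :
    FreeCGA 𝒲 →ₐ[ℚ] A :=
  RingCon.liftₐ (commCon 𝒲) (TensorAlgebra.lift ℚ f)
    (RingCon.ringConGen_le.2 fun x y h => by
      obtain ⟨i, j, a, b, ha, hb⟩ := h
      simpa [RingCon.ker_apply] using hf i j a ha b hb)

theorem lift_gen {W : Type u} [AddCommGroup W] [Module ℚ W] (𝒲 : ℕ → Submodule ℚ W)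
    {A : Type*} [Ring A] [Algebra ℚ A] (f : W →ₗ[ℚ] A)
    (hf : ∀ i j, ∀ a ∈ 𝒲 i, ∀ b ∈ 𝒲 j, f a * f b = (-1) ^ (i * j) * (f b * f a)) (w : W) :
    lift 𝒲 f hf (gen 𝒲 w) = f w :=
  (RingCon.liftₐ_mk _ _ _ _).trans (TensorAlgebra.lift_ι_apply _ w)

/-- `(ΛW)^k`: the span of the products of homogeneous generators of total degree `k`. -/
noncomputable def grade {W : Type u} [AddCommGroup W] [Module ℚ W] (𝒲 : ℕ → Submodule ℚ W) (k : ℕ) :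
    Submodule ℚ (FreeCGA 𝒲) :=
  Submodule.span ℚ {a | ∃ l : List (ℕ × W), (∀ p ∈ l, p.2 ∈ 𝒲 p.1) ∧
    (l.map Prod.fst).sum = k ∧ (l.map fun p => gen 𝒲 p.2).prod = a}

/-- `ΛV ⊆ ΛW` for a set `V` of elements of `W`: the subalgebra generated by `V`. -/
noncomputable def subFree {W : Type u} [AddCommGroup W] [Module ℚ W] (𝒲 : ℕ → Submodule ℚ W)
    (V : Set W) : Subalgebra ℚ (FreeCGA 𝒲) :=
  Algebra.adjoin ℚ (gen 𝒲 '' V)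

/-! ### Differentials and cohomology -/

/-- A differential on `ΛW`, turning it into a commutative differential graded algebra. -/
structure Diff {W : Type u} [AddCommGroup W] [Module ℚ W] (𝒲 : ℕ → Submodule ℚ W) where
  /-- The underlying linear map. -/
  map : FreeCGA 𝒲 →ₗ[ℚ] FreeCGA 𝒲
  map_mem : ∀ (k : ℕ), ∀ a ∈ grade 𝒲 k, map a ∈ grade 𝒲 (k + 1)
  map_map : ∀ a, map (map a) = 0
  leibniz : ∀ (k : ℕ), ∀ a ∈ grade 𝒲 k, ∀ b, map (a * b) = map a * b + (-1) ^ k * (a * map b)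

/-- The cocycles of degree `k`. -/
noncomputable def cocycles {W : Type u} [AddCommGroup W] [Module ℚ W] {𝒲 : ℕ → Submodule ℚ W} (d : Diff 𝒲)
    (k : ℕ) : Submodule ℚ (FreeCGA 𝒲) :=
  grade 𝒲 k ⊓ LinearMap.ker d.map

/-- The coboundaries of degree `k`. -/
noncomputable def coboundaries {W : Type u} [AddCommGroup W] [Module ℚ W] {𝒲 : ℕ → Submodule ℚ W}
    (d : Diff 𝒲) (k : ℕ) : Submodule ℚ (FreeCGA 𝒲) :=
  grade 𝒲 k ⊓ LinearMap.range d.map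

/-- The cohomology `H^k(ΛW, d)`. -/
abbrev Cohomology {W : Type u} [AddCommGroup W] [Module ℚ W] {𝒲 : ℕ → Submodule ℚ W}
    (d : Diff 𝒲) (k : ℕ) : Type u :=
  cocycles d k ⧸ (coboundaries d k).comap (cocycles d k).subtype

/-- The cohomology class of a cocycle. -/
noncomputable def cohClass {W : Type u} [AddCommGroup W] [Module ℚ W] {𝒲 : ℕ → Submodule ℚ W}
    (d : Diff 𝒲) (k : ℕ) : cocycles d k →ₗ[ℚ] Cohomology d k :=
  Submodule.mkQ _

/-! ### Sullivan algebras, ellipticity, formal dimension -/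

/-- `(ΛW, d)` is a Sullivan algebra (of finite type): `W` is graded in positive degrees, of finite
dimension in each degree, and is exhausted by an increasing sequence of graded subspaces
`F 0 ⊆ F 1 ⊆ ⋯` such that `d = 0` on `F 0` and `d (F (k + 1)) ⊆ Λ (F k)`. -/
structure IsSullivan {W : Type u} [AddCommGroup W] [Module ℚ W] {𝒲 : ℕ → Submodule ℚ W}
    (d : Diff 𝒲) : Prop where
  isInternal : DirectSum.IsInternal 𝒲
  finite_degree : ∀ k, FiniteDimensional ℚ (𝒲 k)
  degree_zero : 𝒲 0 = ⊥
  exists_filtration : ∃ F : ℕ → Submodule ℚ W, Monotone F ∧ (⨆ k, F k) = ⊤ ∧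
    (∀ k, F k = ⨆ i, F k ⊓ 𝒲 i) ∧
    (∀ w ∈ F 0, d.map (gen 𝒲 w) = 0) ∧
    ∀ k, ∀ w ∈ F (k + 1), d.map (gen 𝒲 w) ∈ subFree 𝒲 (F k : Set W)

/-- The more restrictive notion of a simply connected Sullivan algebra filtered by degree: `W` is
graded in degrees at least two, of finite dimension in each degree, and `d (W^r) ⊆ Λ (W^{<r})` for
every `r`. -/
structure IsDegreeSullivan {W : Type u} [AddCommGroup W] [Module ℚ W] {𝒲 : ℕ → Submodule ℚ W}
    (d : Diff 𝒲) : Prop where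
  isInternal : DirectSum.IsInternal 𝒲
  finite_degree : ∀ k, FiniteDimensional ℚ (𝒲 k)
  degree_zero : 𝒲 0 = ⊥
  degree_one : 𝒲 1 = ⊥
  map_mem_lower : ∀ (r : ℕ), ∀ w ∈ 𝒲 r,
    d.map (gen 𝒲 w) ∈ subFree 𝒲 {v | ∃ s < r, v ∈ 𝒲 s}

/-- `(ΛW, d)` is elliptic: both `W` and its cohomology are finite-dimensional. -/
def IsElliptic {W : Type u} [AddCommGroup W] [Module ℚ W] {𝒲 : ℕ → Submodule ℚ W}
    (d : Diff 𝒲) : Prop :=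
  FiniteDimensional ℚ W ∧ Module.Finite ℚ (⨁ k, Cohomology d k)

/-- The formal dimension is `N`: the cohomology is one-dimensional in degree `N` and vanishes in
all degrees above `N`. -/
def HasFormalDimension {W : Type u} [AddCommGroup W] [Module ℚ W] {𝒲 : ℕ → Submodule ℚ W}
    (d : Diff 𝒲) (N : ℕ) : Prop :=
  Module.finrank ℚ (Cohomology d N) = 1 ∧ ∀ k, N < k → Subsingleton (Cohomology d k)

/-- `a` represents a fundamental class in degree `N`: it is a cocycle of degree `N` whose class is
a (nonzero) generator of the cohomology in that degree. -/
def RepresentsFundamentalClass {W : Type u} [AddCommGroup W] [Module ℚ W]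
    {𝒲 : ℕ → Submodule ℚ W} (d : Diff 𝒲) (N : ℕ) (a : FreeCGA 𝒲) : Prop :=
  ∃ ha : a ∈ cocycles d N, cohClass d N ⟨a, ha⟩ ≠ 0 ∧
    Submodule.span ℚ {cohClass d N ⟨a, ha⟩} = ⊤

/-- The cohomology is a Poincaré duality algebra of formal dimension `N`: it is finite-dimensional,
one-dimensional in degree `N`, zero above, and the product `H^i × H^{N-i} → H^N` is
nondegenerate. The last condition is written on representatives; degeneracy on the other side is
excluded by graded commutativity. -/
def HasPoincareDuality {W : Type u} [AddCommGroup W] [Module ℚ W] {𝒲 : ℕ → Submodule ℚ W}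
    (d : Diff 𝒲) (N : ℕ) : Prop :=
  Module.Finite ℚ (⨁ k, Cohomology d k) ∧ HasFormalDimension d N ∧
    ∀ i j, i + j = N → ∀ a ∈ cocycles d i, a ∉ coboundaries d i →
      ∃ b ∈ cocycles d j, a * b ∉ coboundaries d N

/-! ### Adjoining one generator -/

/-- The grading of `W ⊕ ℚ y` with `y` of degree `m`. -/
def extend {W : Type u} [AddCommGroup W] [Module ℚ W] (𝒲 : ℕ → Submodule ℚ W) (m : ℕ) :
    ℕ → Submodule ℚ (W × ℚ) :=
  fun k => (𝒲 k).prod (if k = m then ⊤ else ⊥)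

/-- The new generator `y` of `Λ(W ⊕ ℚ y) = ΛW ⊗ Λ(y)`. -/
noncomputable def newGen {W : Type u} [AddCommGroup W] [Module ℚ W] (𝒲 : ℕ → Submodule ℚ W)
    (m : ℕ) : FreeCGA (extend 𝒲 m) :=
  gen (extend 𝒲 m) (0, 1)

/-- The inclusion `ΛW → Λ(W ⊕ ℚ y) = ΛW ⊗ Λ(y)`. -/
noncomputable def incl {W : Type u} [AddCommGroup W] [Module ℚ W] (𝒲 : ℕ → Submodule ℚ W)
    (m : ℕ) : FreeCGA 𝒲 →ₐ[ℚ] FreeCGA (extend 𝒲 m) :=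
  lift 𝒲 (gen (extend 𝒲 m) ∘ₗ LinearMap.inl ℚ W ℚ) fun i j a ha b hb => by
    have ha' : (a, (0 : ℚ)) ∈ extend 𝒲 m i := ⟨ha, Submodule.zero_mem _⟩
    have hb' : (b, (0 : ℚ)) ∈ extend 𝒲 m j := ⟨hb, Submodule.zero_mem _⟩
    exact gen_mul_gen (extend 𝒲 m) ha' hb'

theorem incl_gen {W : Type u} [AddCommGroup W] [Module ℚ W] (𝒲 : ℕ → Submodule ℚ W)
    (m : ℕ) (w : W) : incl 𝒲 m (gen 𝒲 w) = gen (extend 𝒲 m) (w, 0) :=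
  lift_gen _ _ _ w

/-- `d'` is the differential of `(ΛW ⊗ Λ(y), d')`, `deg y = m`, that extends `d` and has
`d' y = x`. -/
def IsExtension {W : Type u} [AddCommGroup W] [Module ℚ W] {𝒲 : ℕ → Submodule ℚ W} (d : Diff 𝒲)
    (m : ℕ) (x : FreeCGA 𝒲) (d' : Diff (extend 𝒲 m)) : Prop :=
  (∀ w : W, d'.map (incl 𝒲 m (gen 𝒲 w)) = incl 𝒲 m (d.map (gen 𝒲 w))) ∧
    d'.map (newGen 𝒲 m) = incl 𝒲 m x

end SullivanModel

/-!
Every element of `Λ(W ⊕ ℚ y) = ΛW ⊗ Λ(y)`, `y` of odd degree `m`, is `a + b y` for unique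
`a, b ∈ ΛW`. Existence (`pair_surjective`) follows from `y² = 0` and `y a = σ(a) y`, where `σ` is
the sign automorphism. Uniqueness (`pair_injective`) is the freeness of the algebra: by the
universal property `a + b y ↦ !![a, b; 0, σ a]` is a representation over `ΛW`. The degrees of `ΛW`
are separated by the coaction `a ↦ a X ^ k` into `ΛW[X]`, which also comes from the universal
property and provides the homogeneous components.

In these coordinates an extension of `d` with `d y = x` can only be
`(a, b) ↦ (d a + σ(b) x, d b)` (`IsExtension.map_pair`). For a cocycle `x` of even degree `m + 1`
this formula does define a differential (`exists_isExtension`).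

The cohomology is then computed by hand, as in the Gysin sequence. The cohomology of `ΛW` in
degrees at least `m + 1` is spanned by the class of `x`, which becomes exact. Hence, in degrees
`j + m` with `j > 0`, the cocycle `a + b y` is exact if and only if `b` is
(`IsExtension.pair_mem_coboundaries_iff`), and every cocycle `b` of degree `j` occurs in a cocycle
`a + b y`, because `σ(b) x` lies above the formal dimension and is exact
(`IsExtension.exists_pair_mem_cocycles`). In degrees at most `m` there are no cocycles besides
those of `ΛW` (`IsExtension.exists_eq_of_mem_cocycles`). So the top class is that of `x y - z`, and
`H^i × H^{2m+1-i} → H^{2m+1}` reduces to a pairing of the cohomology of `ΛW` into degree `m + 1`.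
Finite-dimensionality holds because words of degree `k` in positive degree letters have at most `k`
letters.
-/

namespace SullivanModel

/-! ### The grading of the free commutative graded algebra -/

section Grading

variable {W : Type*} [AddCommGroup W] [Module ℚ W] {𝒲 : ℕ → Submodule ℚ W}

theorem mk_surjective (𝒲 : ℕ → Submodule ℚ W) : Function.Surjective (mk 𝒲) :=
  Quotient.mk_surjective

theorem adjoin_range_gen (𝒲 : ℕ → Submodule ℚ W) :
    Algebra.adjoin ℚ (Set.range (gen 𝒲)) = ⊤ := by
  have h : Set.range (gen 𝒲) = mk 𝒲 '' Set.range (TensorAlgebra.ι ℚ) := by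
    rw [← Set.range_comp]; rfl
  rw [h, ← AlgHom.map_adjoin, TensorAlgebra.adjoin_range_ι, Algebra.map_top,
    AlgHom.range_eq_top]
  exact mk_surjective 𝒲

theorem freeCGA_induction {p : FreeCGA 𝒲 → Prop} (hgen : ∀ w, p (gen 𝒲 w))
    (hscalar : ∀ c : ℚ, p (c • 1)) (hadd : ∀ a b, p a → p b → p (a + b))
    (hmul : ∀ a b, p a → p b → p (a * b)) (a : FreeCGA 𝒲) : p a := by
  have ha : a ∈ Algebra.adjoin ℚ (Set.range (gen 𝒲)) := by
    rw [adjoin_range_gen]; exact Algebra.mem_top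
  induction ha using Algebra.adjoin_induction with
  | mem a ha => obtain ⟨w, rfl⟩ := ha; exact hgen w
  | algebraMap r => rw [Algebra.algebraMap_eq_smul_one]; exact hscalar r
  | add a b _ _ ha hb => exact hadd a b ha hb
  | mul a b _ _ ha hb => exact hmul a b ha hb

theorem gen_mem_grade {k : ℕ} {w : W} (hw : w ∈ 𝒲 k) : gen 𝒲 w ∈ grade 𝒲 k :=
  Submodule.subset_span ⟨[(k, w)], by simpa using hw, by simp, by simp⟩

theorem one_mem_grade : (1 : FreeCGA 𝒲) ∈ grade 𝒲 0 :=
  Submodule.subset_span ⟨[], by simp, by simp, by simp⟩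

theorem grade_mul_le (i j : ℕ) : grade 𝒲 i * grade 𝒲 j ≤ grade 𝒲 (i + j) := by
  unfold grade
  rw [Submodule.span_mul_span]
  refine Submodule.span_mono ?_
  rintro _ ⟨_, ⟨l, hl, rfl, rfl⟩, _, ⟨l', hl', rfl, rfl⟩, rfl⟩
  refine ⟨l ++ l', ?_, by simp, by simp⟩
  intro p hp
  rcases List.mem_append.1 hp with h | h
  exacts [hl p h, hl' p h]

theorem mul_mem_grade {i j : ℕ} {a b : FreeCGA 𝒲} (ha : a ∈ grade 𝒲 i) (hb : b ∈ grade 𝒲 j) :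
    a * b ∈ grade 𝒲 (i + j) :=
  grade_mul_le i j (Submodule.mul_mem_mul ha hb)

theorem iSup_grade (h : ⨆ k, 𝒲 k = ⊤) : ⨆ k, grade 𝒲 k = ⊤ := by
  rw [eq_top_iff]
  rintro a -
  refine freeCGA_induction (fun w => ?_) (fun c => ?_) (fun a b ha hb => Submodule.add_mem _ ha hb)
    (fun a b ha hb => ?_) a
  · have hw : gen 𝒲 w ∈ (⨆ k, 𝒲 k).map (gen 𝒲) := ⟨w, by rw [h]; trivial, rfl⟩
    rw [Submodule.map_iSup] at hw
    have hle : ⨆ k, (𝒲 k).map (gen 𝒲) ≤ ⨆ k, grade 𝒲 k :=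
      iSup_mono fun k => Submodule.map_le_iff_le_comap.2 fun v hv => gen_mem_grade hv
    exact hle hw
  · exact Submodule.smul_mem _ _ (Submodule.mem_iSup_of_mem 0 one_mem_grade)
  · have hab := Submodule.mul_mem_mul ha hb
    rw [Submodule.iSup_mul] at hab
    refine (iSup_le fun i => ?_ : _ ≤ ⨆ k, grade 𝒲 k) hab
    rw [Submodule.mul_iSup]
    exact iSup_le fun j => (grade_mul_le i j).trans (le_iSup (grade 𝒲) (i + j))

/-- Linear maps out of `ΛW` that agree on homogeneous elements are equal. -/
theorem linearMap_ext_grade {A : Type*} [AddCommGroup A] [Module ℚ A] (h : ⨆ k, 𝒲 k = ⊤)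
    {f g : FreeCGA 𝒲 →ₗ[ℚ] A} (hfg : ∀ k, ∀ a ∈ grade 𝒲 k, f a = g a) : f = g := by
  have hle : ⨆ k, grade 𝒲 k ≤ LinearMap.eqLocus f g := iSup_le hfg
  rw [iSup_grade h, top_le_iff] at hle
  exact LinearMap.eqLocus_eq_top.1 hle

/-- A linear map out of an internal direct sum is given by its restrictions to the summands. -/
theorem exists_linearMap_of_isInternal {A : Type*} [AddCommGroup A] [Module ℚ A]
    (h : DirectSum.IsInternal 𝒲) (g : ℕ → W →ₗ[ℚ] A) :
    ∃ f : W →ₗ[ℚ] A, ∀ k, ∀ w ∈ 𝒲 k, f w = g k w := by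
  let e := LinearEquiv.ofBijective (DirectSum.coeLinearMap 𝒲) h
  refine ⟨DirectSum.toModule ℚ ℕ A (fun k => g k ∘ₗ (𝒲 k).subtype) ∘ₗ e.symm.toLinearMap, ?_⟩
  intro k w hw
  have he : e.symm w = DirectSum.lof ℚ ℕ (fun k => 𝒲 k) k ⟨w, hw⟩ := by
    rw [LinearEquiv.symm_apply_eq]
    exact (DirectSum.coeLinearMap_lof 𝒲 k ⟨w, hw⟩).symm
  simp [he]

/-- The degree operator in multiplicative form: every algebra homomorphism `g` on `ΛW` can be
twisted by a central element `t`, so as to become `a ↦ g a * t ^ k` in degree `k`. The choice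
`t = -1` gives the sign automorphism, and `t = X` separates the degrees. -/
theorem exists_twist {A : Type*} [Ring A] [Algebra ℚ A] (h : DirectSum.IsInternal 𝒲)
    (g : FreeCGA 𝒲 →ₐ[ℚ] A) (t : A) (ht : ∀ a, Commute t a) :
    ∃ f : FreeCGA 𝒲 →ₐ[ℚ] A, ∀ k, ∀ a ∈ grade 𝒲 k, f a = g a * t ^ k := by
  obtain ⟨f, hf⟩ := exists_linearMap_of_isInternal h
    (fun k => LinearMap.mulRight ℚ (t ^ k) ∘ₗ g.toLinearMap ∘ₗ gen 𝒲)
  have key (a b : A) (i j : ℕ) : a * t ^ i * (b * t ^ j) = a * b * t ^ (i + j) := by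
    rw [mul_assoc, ← mul_assoc (t ^ i), ((ht b).pow_left i).eq, pow_add]
    simp only [mul_assoc]
  have hcomm : ∀ i j, ∀ a ∈ 𝒲 i, ∀ b ∈ 𝒲 j, f a * f b = (-1) ^ (i * j) * (f b * f a) := by
    intro i j a ha b hb
    have e := congrArg g (gen_mul_gen 𝒲 ha hb)
    simp only [map_mul, map_pow, map_neg, map_one] at e
    simp only [hf i a ha, hf j b hb, LinearMap.comp_apply, LinearMap.mulRight_apply,
      AlgHom.toLinearMap_apply, key, e, add_comm j i, mul_assoc]
  refine ⟨lift 𝒲 f hcomm, fun k a ha => ?_⟩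
  induction ha using Submodule.span_induction with
  | mem a ha =>
    obtain ⟨l, hl, rfl, rfl⟩ := ha
    induction l with
    | nil => simp
    | cons p l ih =>
      simp only [List.map_cons, List.prod_cons, List.sum_cons, map_mul]
      rw [ih fun q hq => hl q (List.mem_cons_of_mem _ hq), lift_gen,
        hf p.1 p.2 (hl p List.mem_cons_self)]
      simp only [LinearMap.comp_apply, LinearMap.mulRight_apply, AlgHom.toLinearMap_apply, key]
  | zero => simp
  | add a b _ _ ha hb => simp [ha, hb, add_mul]
  | smul c a _ ha => simp [ha]

/-- The sign automorphism `a ↦ (-1) ^ k a` for `a` of degree `k`. -/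
noncomputable def sgn (h : DirectSum.IsInternal 𝒲) : FreeCGA 𝒲 →ₐ[ℚ] FreeCGA 𝒲 :=
  (exists_twist h (AlgHom.id ℚ _) (-1) fun a => (Commute.one_left a).neg_left).choose

theorem sgn_of_mem (h : DirectSum.IsInternal 𝒲) {k : ℕ} {a : FreeCGA 𝒲} (ha : a ∈ grade 𝒲 k) :
    sgn h a = (-1) ^ k * a := by
  have := (exists_twist h (AlgHom.id ℚ (FreeCGA 𝒲)) (-1)
    fun a => (Commute.one_left a).neg_left).choose_spec k a ha
  rw [sgn, this, AlgHom.id_apply, (((Commute.one_right a).neg_right).pow_right k).eq]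

/-- The coaction `a ↦ a X ^ k` for `a` of degree `k`. -/
noncomputable def coact (h : DirectSum.IsInternal 𝒲) :
    FreeCGA 𝒲 →ₐ[ℚ] Polynomial (FreeCGA 𝒲) :=
  (exists_twist h (Polynomial.CAlgHom (R := ℚ)) Polynomial.X Polynomial.commute_X).choose

theorem coact_of_mem (h : DirectSum.IsInternal 𝒲) {k : ℕ} {a : FreeCGA 𝒲}
    (ha : a ∈ grade 𝒲 k) : coact h a = Polynomial.C a * Polynomial.X ^ k :=
  (exists_twist h (Polynomial.CAlgHom (R := ℚ)) Polynomial.X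
    Polynomial.commute_X).choose_spec k a ha

/-- The homogeneous component of degree `k`. -/
noncomputable def proj (h : DirectSum.IsInternal 𝒲) (k : ℕ) : FreeCGA 𝒲 →ₗ[ℚ] FreeCGA 𝒲 :=
  (Polynomial.lcoeff (FreeCGA 𝒲) k).restrictScalars ℚ ∘ₗ (coact h).toLinearMap

theorem proj_of_mem (h : DirectSum.IsInternal 𝒲) {j : ℕ} (k : ℕ) {a : FreeCGA 𝒲}
    (ha : a ∈ grade 𝒲 j) : proj h k a = if k = j then a else 0 := by
  simp [proj, coact_of_mem h ha, Polynomial.coeff_X_pow]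

theorem proj_same (h : DirectSum.IsInternal 𝒲) {k : ℕ} {a : FreeCGA 𝒲}
    (ha : a ∈ grade 𝒲 k) : proj h k a = a := by
  rw [proj_of_mem h k ha, if_pos rfl]

theorem proj_mem (h : DirectSum.IsInternal 𝒲) (k : ℕ) (a : FreeCGA 𝒲) :
    proj h k a ∈ grade 𝒲 k := by
  have hle : ⨆ j, grade 𝒲 j ≤ (grade 𝒲 k).comap (proj h k) := by
    refine iSup_le fun j a ha => ?_
    rw [Submodule.mem_comap, proj_of_mem h k ha]
    split_ifs with hk
    · rwa [hk]
    · exact Submodule.zero_mem _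
  rw [iSup_grade h.submodule_iSup_eq_top] at hle
  exact hle trivial

theorem mem_grade_iff_proj (h : DirectSum.IsInternal 𝒲) {k : ℕ} {a : FreeCGA 𝒲} :
    a ∈ grade 𝒲 k ↔ proj h k a = a :=
  ⟨proj_same h, fun e => e ▸ proj_mem h k a⟩

theorem sgn_mem (h : DirectSum.IsInternal 𝒲) {k : ℕ} {a : FreeCGA 𝒲} (ha : a ∈ grade 𝒲 k) :
    sgn h a ∈ grade 𝒲 k := by
  rw [sgn_of_mem h ha]
  rcases neg_one_pow_eq_or (FreeCGA 𝒲) k with e | e <;> simp [e, ha]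

theorem sgn_sgn (h : DirectSum.IsInternal 𝒲) (a : FreeCGA 𝒲) : sgn h (sgn h a) = a := by
  have : (sgn h).toLinearMap ∘ₗ (sgn h).toLinearMap = LinearMap.id := by
    refine linearMap_ext_grade h.submodule_iSup_eq_top fun k a ha => ?_
    simp only [LinearMap.comp_apply, AlgHom.toLinearMap_apply, LinearMap.id_apply]
    rw [sgn_of_mem h (sgn_mem h ha), sgn_of_mem h ha]
    rcases neg_one_pow_eq_or (FreeCGA 𝒲) k with e | e <;> simp [e]
  exact LinearMap.congr_fun this a

/-- Homogeneous elements of `ΛW` commute in the graded sense. -/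
theorem mul_comm_of_mem {i j : ℕ} {a b : FreeCGA 𝒲} (ha : a ∈ grade 𝒲 i)
    (hb : b ∈ grade 𝒲 j) : a * b = (-1) ^ (i * j) * (b * a) := by
  have hgen : ∀ {i j : ℕ} {w : W} {b : FreeCGA 𝒲}, w ∈ 𝒲 i → b ∈ grade 𝒲 j →
      gen 𝒲 w * b = (-1) ^ (i * j) * (b * gen 𝒲 w) := by
    intro i j w b hw hb
    induction hb using Submodule.span_induction with
    | mem b hb =>
      obtain ⟨l, hl, rfl, rfl⟩ := hb
      induction l with
      | nil => simp
      | cons p l ih =>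
        have ih' := ih fun q hq => hl q (List.mem_cons_of_mem _ hq)
        simp only [List.map_cons, List.prod_cons, List.sum_cons]
        rw [← mul_assoc, gen_mul_gen 𝒲 hw (hl p List.mem_cons_self), mul_assoc, mul_assoc, ih',
          mul_add, pow_add]
        rcases neg_one_pow_eq_or (FreeCGA 𝒲) (i * (l.map Prod.fst).sum) with e | e <;>
          simp [e, mul_assoc]
    | zero => simp
    | add b c _ _ hb hc => rw [mul_add, hb, hc, add_mul, mul_add]
    | smul r b _ hb => rw [mul_smul_comm, hb, smul_mul_assoc, mul_smul_comm]
  induction ha using Submodule.span_induction with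
  | mem a ha =>
    obtain ⟨l, hl, rfl, rfl⟩ := ha
    induction l with
    | nil => simp
    | cons p l ih =>
      have ih' := ih fun q hq => hl q (List.mem_cons_of_mem _ hq)
      simp only [List.map_cons, List.prod_cons, List.sum_cons]
      rw [mul_assoc, ih', add_mul, pow_add]
      have e2 := hgen (hl p List.mem_cons_self) hb
      rcases neg_one_pow_eq_or (FreeCGA 𝒲) ((l.map Prod.fst).sum * j) with e | e <;>
        simp [e, ← mul_assoc, e2]
  | zero => simp
  | add a c _ _ ha hc => rw [add_mul, ha, hc, mul_add, mul_add]
  | smul r a _ ha => rw [mul_smul_comm, smul_mul_assoc, ha, mul_smul_comm]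

/-- An element of odd degree passes through `ΛW` at the cost of the sign automorphism. -/
theorem odd_mul (h : DirectSum.IsInternal 𝒲) {k : ℕ} (hk : Odd k) {a : FreeCGA 𝒲}
    (ha : a ∈ grade 𝒲 k) (b : FreeCGA 𝒲) : a * b = sgn h b * a := by
  have : LinearMap.mulLeft ℚ a = LinearMap.mulRight ℚ a ∘ₗ (sgn h).toLinearMap := by
    refine linearMap_ext_grade h.submodule_iSup_eq_top fun j b hb => ?_
    simp only [LinearMap.comp_apply, AlgHom.toLinearMap_apply, LinearMap.mulLeft_apply,
      LinearMap.mulRight_apply]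
    rw [mul_comm_of_mem ha hb, sgn_of_mem h hb, pow_mul, hk.neg_one_pow, mul_assoc]
  exact LinearMap.congr_fun this b

theorem even_mul (h : DirectSum.IsInternal 𝒲) {k : ℕ} (hk : Even k) {a : FreeCGA 𝒲}
    (ha : a ∈ grade 𝒲 k) (b : FreeCGA 𝒲) : a * b = b * a := by
  have : LinearMap.mulLeft ℚ a = LinearMap.mulRight ℚ a := by
    refine linearMap_ext_grade h.submodule_iSup_eq_top fun j b hb => ?_
    simp only [LinearMap.mulLeft_apply, LinearMap.mulRight_apply]
    rw [mul_comm_of_mem ha hb, pow_mul, hk.neg_one_pow, one_pow, one_mul]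
  exact LinearMap.congr_fun this b

theorem grade_zero_le (h0 : 𝒲 0 = ⊥) {a : FreeCGA 𝒲} (ha : a ∈ grade 𝒲 0) :
    ∃ c : ℚ, a = c • 1 := by
  have hle : grade 𝒲 0 ≤ Submodule.span ℚ {1} := by
    refine Submodule.span_le.2 ?_
    rintro _ ⟨l, hl, hs, rfl⟩
    cases l with
    | nil => exact Submodule.mem_span_singleton_self _
    | cons p l =>
      have hp : p.1 = 0 := by simp at hs; exact hs.1
      have hp2 : p.2 = 0 := by
        have := hl p List.mem_cons_self
        rwa [hp, h0, Submodule.mem_bot] at this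
      simp [hp2]
  obtain ⟨c, hc⟩ := Submodule.mem_span_singleton.1 (hle ha)
  exact ⟨c, hc.symm⟩

/-- If `W` is finite-dimensional and positively graded, then `ΛW` is finite-dimensional in each
degree, since words of degree `k` have at most `k` letters. -/
theorem finiteDimensional_grade [FiniteDimensional ℚ W] (h0 : 𝒲 0 = ⊥) (k : ℕ) :
    FiniteDimensional ℚ (grade 𝒲 k) := by
  let S : Submodule ℚ (FreeCGA 𝒲) := 1 ⊔ LinearMap.range (gen 𝒲)
  have h1 : 1 ≤ S := le_sup_left
  have hS : S.FG := by
    refine Submodule.FG.sup ?_ ?_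
    · rw [Submodule.one_eq_span]
      exact Submodule.fg_span_singleton _
    · rw [LinearMap.range_eq_map]
      exact Module.Finite.fg_top.map _
  have hle : grade 𝒲 k ≤ S ^ k := by
    refine Submodule.span_le.2 ?_
    rintro _ ⟨l, hl, rfl, rfl⟩
    induction l with
    | nil => exact Submodule.one_le.1 (by simp)
    | cons p l ih =>
      simp only [List.map_cons, List.prod_cons, List.sum_cons, pow_add]
      refine Submodule.mul_mem_mul ?_ (ih fun q hq => hl q (List.mem_cons_of_mem _ hq))
      have hp := hl p List.mem_cons_self
      rcases Nat.eq_zero_or_pos p.1 with h | h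
      · rw [h, h0, Submodule.mem_bot] at hp
        simp [hp]
      · have hg : gen 𝒲 p.2 ∈ S ^ 1 := by
          rw [pow_one]
          exact Submodule.mem_sup_right (LinearMap.mem_range_self _ _)
        exact pow_le_pow_right₀ h1 h hg
  have : FiniteDimensional ℚ (S ^ k : Submodule ℚ (FreeCGA 𝒲)) :=
    Module.Finite.iff_fg.2 (hS.pow k)
  exact Submodule.finiteDimensional_of_le hle

end Grading

/-! ### Differentials and their cohomology -/

section Differential

variable {W : Type*} [AddCommGroup W] [Module ℚ W] {𝒲 : ℕ → Submodule ℚ W}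

theorem Diff.ext_map {d₁ d₂ : Diff 𝒲} (h : d₁.map = d₂.map) : d₁ = d₂ := by
  cases d₁; cases d₂; cases h; rfl

variable (d : Diff 𝒲)

theorem Diff.map_one : d.map 1 = 0 := by
  have h := d.leibniz 0 1 one_mem_grade 1
  simpa using h

theorem Diff.map_mul (h : DirectSum.IsInternal 𝒲) (a b : FreeCGA 𝒲) :
    d.map (a * b) = d.map a * b + sgn h a * d.map b := by
  have key : d.map ∘ₗ LinearMap.mulRight ℚ b =
      LinearMap.mulRight ℚ b ∘ₗ d.map +
        LinearMap.mulRight ℚ (d.map b) ∘ₗ (sgn h).toLinearMap := by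
    refine linearMap_ext_grade h.submodule_iSup_eq_top fun k a ha => ?_
    simp [d.leibniz k a ha b, sgn_of_mem h ha, mul_assoc]
  exact LinearMap.congr_fun key a

theorem Diff.sgn_map (h : DirectSum.IsInternal 𝒲) (a : FreeCGA 𝒲) :
    sgn h (d.map a) = -d.map (sgn h a) := by
  have key : (sgn h).toLinearMap ∘ₗ d.map = -(d.map ∘ₗ (sgn h).toLinearMap) := by
    refine linearMap_ext_grade h.submodule_iSup_eq_top fun k a ha => ?_
    simp only [LinearMap.comp_apply, LinearMap.neg_apply, AlgHom.toLinearMap_apply]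
    rw [sgn_of_mem h (d.map_mem k a ha), sgn_of_mem h ha, pow_succ]
    rcases neg_one_pow_eq_or (FreeCGA 𝒲) k with e | e <;> simp [e]
  exact LinearMap.congr_fun key a

theorem Diff.proj_succ_map (h : DirectSum.IsInternal 𝒲) (k : ℕ) (a : FreeCGA 𝒲) :
    proj h (k + 1) (d.map a) = d.map (proj h k a) := by
  have key : proj h (k + 1) ∘ₗ d.map = d.map ∘ₗ proj h k := by
    refine linearMap_ext_grade h.submodule_iSup_eq_top fun j a ha => ?_
    simp only [LinearMap.comp_apply]
    rw [proj_of_mem h _ (d.map_mem j a ha), proj_of_mem h _ ha]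
    by_cases hk : k = j <;> simp [hk]
  exact LinearMap.congr_fun key a

theorem Diff.exists_mem_map_eq (h : DirectSum.IsInternal 𝒲) {k : ℕ} {a : FreeCGA 𝒲}
    (ha : a ∈ coboundaries d (k + 1)) : ∃ c ∈ grade 𝒲 k, d.map c = a := by
  obtain ⟨ha, c, rfl⟩ := ha
  exact ⟨proj h k c, proj_mem h k c, by rw [← d.proj_succ_map h, proj_same h ha]⟩

theorem mul_mem_cocycles {i j : ℕ} {a b : FreeCGA 𝒲} (ha : a ∈ cocycles d i)
    (hb : b ∈ cocycles d j) : a * b ∈ cocycles d (i + j) := by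
  refine ⟨mul_mem_grade ha.1 hb.1, ?_⟩
  have ha' : d.map a = 0 := ha.2
  have hb' : d.map b = 0 := hb.2
  refine LinearMap.mem_ker.2 ?_
  rw [d.leibniz i a ha.1, ha', hb']
  simp

theorem subsingleton_cohomology_iff (k : ℕ) :
    Subsingleton (Cohomology d k) ↔ cocycles d k ≤ coboundaries d k := by
  rw [Submodule.Quotient.subsingleton_iff, Submodule.comap_subtype_eq_top]

theorem cohClass_eq_zero_iff {k : ℕ} (a : cocycles d k) :
    cohClass d k a = 0 ↔ (a : FreeCGA 𝒲) ∈ coboundaries d k := by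
  rw [cohClass, Submodule.mkQ_apply, Submodule.Quotient.mk_eq_zero]
  rfl

theorem representsFundamentalClass_iff {N : ℕ} {a : FreeCGA 𝒲} :
    RepresentsFundamentalClass d N a ↔ a ∈ cocycles d N ∧ a ∉ coboundaries d N ∧
      ∀ c ∈ cocycles d N, ∃ r : ℚ, c - r • a ∈ coboundaries d N := by
  constructor
  · rintro ⟨ha, h0, hspan⟩
    refine ⟨ha, fun h => h0 ((cohClass_eq_zero_iff d _).2 h), fun c hc => ?_⟩
    have hmem : cohClass d N ⟨c, hc⟩ ∈ Submodule.span ℚ {cohClass d N ⟨a, ha⟩} := by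
      rw [hspan]; trivial
    obtain ⟨r, hr⟩ := Submodule.mem_span_singleton.1 hmem
    refine ⟨r, (cohClass_eq_zero_iff d (⟨c, hc⟩ - r • ⟨a, ha⟩)).1 ?_⟩
    rw [map_sub, map_smul, hr, sub_self]
  · rintro ⟨ha, h0, hspan⟩
    refine ⟨ha, fun h => h0 ((cohClass_eq_zero_iff d _).1 h), ?_⟩
    rw [eq_top_iff]
    rintro y -
    obtain ⟨⟨c, hc⟩, rfl⟩ := Submodule.mkQ_surjective _ y
    obtain ⟨r, hr⟩ := hspan c hc
    refine Submodule.mem_span_singleton.2 ⟨r, ?_⟩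
    have := (cohClass_eq_zero_iff d (⟨c, hc⟩ - r • ⟨a, ha⟩)).2 hr
    rw [map_sub, map_smul, sub_eq_zero] at this
    exact this.symm

theorem finrank_cohomology_eq_one {N : ℕ} {a : FreeCGA 𝒲}
    (h : RepresentsFundamentalClass d N a) : Module.finrank ℚ (Cohomology d N) = 1 := by
  obtain ⟨ha, h0, hspan⟩ := h
  rw [finrank_eq_one_iff']
  refine ⟨_, h0, fun w => Submodule.mem_span_singleton.1 ?_⟩
  rw [hspan]; trivial

/-- If `W` is finite-dimensional and positively graded, bounded cohomology is finite-dimensional. -/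
theorem finite_cohomology [FiniteDimensional ℚ W] (h0 : 𝒲 0 = ⊥) {N : ℕ}
    (hN : ∀ k, N < k → Subsingleton (Cohomology d k)) :
    Module.Finite ℚ (⨁ k, Cohomology d k) := by
  have hfin (k : ℕ) : Module.Finite ℚ (Cohomology d k) := by
    have := finiteDimensional_grade h0 k
    have : FiniteDimensional ℚ (cocycles d k) :=
      Submodule.finiteDimensional_of_le (inf_le_left : cocycles d k ≤ grade 𝒲 k)
    infer_instance
  let f : (∀ i : Fin (N + 1), Cohomology d i) →ₗ[ℚ] ⨁ k, Cohomology d k :=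
    ∑ i : Fin (N + 1), DirectSum.lof ℚ ℕ (fun k => Cohomology d k) i ∘ₗ LinearMap.proj i
  refine Module.Finite.of_surjective f ?_
  rw [← LinearMap.range_eq_top, eq_top_iff]
  rintro y -
  induction y using DirectSum.induction_on with
  | zero => exact Submodule.zero_mem _
  | add y z hy hz => exact Submodule.add_mem _ hy hz
  | of k c =>
    by_cases hk : N < k
    · have := hN k hk
      rw [Subsingleton.elim c 0, map_zero]
      exact Submodule.zero_mem _
    · refine ⟨Pi.single (⟨k, by omega⟩ : Fin (N + 1)) c, ?_⟩
      simp only [f, LinearMap.sum_apply, LinearMap.comp_apply, LinearMap.proj_apply]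
      rw [Finset.sum_eq_single (⟨k, by omega⟩ : Fin (N + 1))]
      · rw [Pi.single_eq_same]; rfl
      · intro i _ hi
        rw [Pi.single_eq_of_ne hi, map_zero]
      · intro h; exact absurd (Finset.mem_univ _) h

end Differential

/-! ### The algebra `ΛW ⊗ Λ(y)` for a generator `y` of odd degree -/

section Extension

variable {W : Type*} [AddCommGroup W] [Module ℚ W] {𝒲 : ℕ → Submodule ℚ W}

theorem isInternal_extend (h : DirectSum.IsInternal 𝒲) (m : ℕ) :
    DirectSum.IsInternal (extend 𝒲 m) := by
  rw [DirectSum.isInternal_submodule_iff_iSupIndep_and_iSup_eq_top]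
  constructor
  · intro i
    have hle : ⨆ j, ⨆ (_ : j ≠ i), extend 𝒲 m j ≤
        (⨆ j, ⨆ (_ : j ≠ i), 𝒲 j).prod (if i = m then ⊥ else ⊤) := by
      refine iSup₂_le fun j hj => Submodule.prod_mono ?_ ?_
      · exact le_iSup₂ (f := fun j (_ : j ≠ i) => 𝒲 j) j hj
      · by_cases hi : i = m
        · rw [if_neg (by omega)]; exact bot_le
        · rw [if_neg hi]; exact le_top
    refine Disjoint.mono_right hle ?_
    rw [Submodule.disjoint_def]
    rintro ⟨w, t⟩ ⟨h1, h2⟩ ⟨h3, h4⟩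
    have hw : w = 0 := Submodule.disjoint_def.1 (h.submodule_iSupIndep i) w h1 h3
    have ht : t = 0 := by
      by_cases hi : i = m
      · simpa [hi] using h4
      · simpa [hi] using h2
    rw [hw, ht]; rfl
  · rw [eq_top_iff]
    rintro ⟨w, t⟩ -
    have hw : w ∈ ⨆ k, 𝒲 k := by rw [h.submodule_iSup_eq_top]; trivial
    have h1 : (w, (0 : ℚ)) ∈ ⨆ k, extend 𝒲 m k := by
      have hle : ⨆ k, 𝒲 k ≤ (⨆ k, extend 𝒲 m k).comap (LinearMap.inl ℚ W ℚ) :=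
        iSup_le fun k v hv => Submodule.mem_iSup_of_mem k ⟨hv, Submodule.zero_mem _⟩
      exact hle hw
    have h2 : ((0 : W), t) ∈ ⨆ k, extend 𝒲 m k :=
      Submodule.mem_iSup_of_mem m ⟨Submodule.zero_mem _, by simp⟩
    simpa using Submodule.add_mem _ h1 h2

theorem incl_mem_grade {m k : ℕ} {a : FreeCGA 𝒲} (ha : a ∈ grade 𝒲 k) :
    incl 𝒲 m a ∈ grade (extend 𝒲 m) k := by
  have hle : grade 𝒲 k ≤ (grade (extend 𝒲 m) k).comap (incl 𝒲 m).toLinearMap := by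
    refine Submodule.span_le.2 ?_
    rintro _ ⟨l, hl, rfl, rfl⟩
    refine Submodule.subset_span ⟨l.map fun p => (p.1, (p.2, 0)), ?_, ?_, ?_⟩
    · intro p hp
      obtain ⟨q, hq, rfl⟩ := List.mem_map.1 hp
      exact ⟨hl q hq, Submodule.zero_mem _⟩
    · simp [Function.comp_def]
    · simp [Function.comp_def, map_list_prod, incl_gen]
  exact hle ha

theorem newGen_mem_grade (m : ℕ) : newGen 𝒲 m ∈ grade (extend 𝒲 m) m :=
  gen_mem_grade ⟨Submodule.zero_mem _, by simp⟩

theorem gen_extend (m : ℕ) (w : W) (t : ℚ) :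
    gen (extend 𝒲 m) (w, t) = incl 𝒲 m (gen 𝒲 w) + t • newGen 𝒲 m := by
  rw [incl_gen, newGen, ← map_smul, ← map_add]
  simp

/-- The linear map `(a, b) ↦ a + b y` from `ΛW × ΛW` to `ΛW ⊗ Λ(y)`. -/
noncomputable def pair (𝒲 : ℕ → Submodule ℚ W) (m : ℕ) :
    FreeCGA 𝒲 × FreeCGA 𝒲 →ₗ[ℚ] FreeCGA (extend 𝒲 m) :=
  LinearMap.coprod (incl 𝒲 m).toLinearMap
    (LinearMap.mulRight ℚ (newGen 𝒲 m) ∘ₗ (incl 𝒲 m).toLinearMap)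

theorem pair_apply (m : ℕ) (a b : FreeCGA 𝒲) :
    pair 𝒲 m (a, b) = incl 𝒲 m a + incl 𝒲 m b * newGen 𝒲 m := rfl

theorem sgn_incl (h : DirectSum.IsInternal 𝒲) (m : ℕ) (a : FreeCGA 𝒲) :
    sgn (isInternal_extend h m) (incl 𝒲 m a) = incl 𝒲 m (sgn h a) := by
  have key : (sgn (isInternal_extend h m)).toLinearMap ∘ₗ (incl 𝒲 m).toLinearMap =
      (incl 𝒲 m).toLinearMap ∘ₗ (sgn h).toLinearMap := by
    refine linearMap_ext_grade h.submodule_iSup_eq_top fun k a ha => ?_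
    simp [sgn_of_mem h ha, sgn_of_mem _ (incl_mem_grade (m := m) ha)]
  exact LinearMap.congr_fun key a

theorem proj_incl (h : DirectSum.IsInternal 𝒲) (m k : ℕ) (a : FreeCGA 𝒲) :
    proj (isInternal_extend h m) k (incl 𝒲 m a) = incl 𝒲 m (proj h k a) := by
  have key : proj (isInternal_extend h m) k ∘ₗ (incl 𝒲 m).toLinearMap =
      (incl 𝒲 m).toLinearMap ∘ₗ proj h k := by
    refine linearMap_ext_grade h.submodule_iSup_eq_top fun j a ha => ?_
    simp only [LinearMap.comp_apply, AlgHom.toLinearMap_apply]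
    rw [proj_of_mem _ k (incl_mem_grade ha), proj_of_mem h k ha]
    split_ifs <;> simp
  exact LinearMap.congr_fun key a

theorem proj_incl_mul_newGen (h : DirectSum.IsInternal 𝒲) (m j : ℕ) (b : FreeCGA 𝒲) :
    proj (isInternal_extend h m) (j + m) (incl 𝒲 m b * newGen 𝒲 m) =
      incl 𝒲 m (proj h j b) * newGen 𝒲 m := by
  have key : proj (isInternal_extend h m) (j + m) ∘ₗ LinearMap.mulRight ℚ (newGen 𝒲 m) ∘ₗ
      (incl 𝒲 m).toLinearMap =
      LinearMap.mulRight ℚ (newGen 𝒲 m) ∘ₗ (incl 𝒲 m).toLinearMap ∘ₗ proj h j := by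
    refine linearMap_ext_grade h.submodule_iSup_eq_top fun i b hb => ?_
    simp only [LinearMap.comp_apply, AlgHom.toLinearMap_apply, LinearMap.mulRight_apply]
    rw [proj_of_mem _ (j + m) (mul_mem_grade (incl_mem_grade hb) (newGen_mem_grade m)),
      proj_of_mem h j hb]
    by_cases hj : j = i <;> simp [hj]
  exact LinearMap.congr_fun key b

theorem proj_incl_mul_newGen_of_lt (h : DirectSum.IsInternal 𝒲) {m k : ℕ} (hk : k < m)
    (b : FreeCGA 𝒲) :
    proj (isInternal_extend h m) k (incl 𝒲 m b * newGen 𝒲 m) = 0 := by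
  have key : proj (isInternal_extend h m) k ∘ₗ LinearMap.mulRight ℚ (newGen 𝒲 m) ∘ₗ
      (incl 𝒲 m).toLinearMap = 0 := by
    refine linearMap_ext_grade h.submodule_iSup_eq_top fun i b hb => ?_
    simp only [LinearMap.comp_apply, AlgHom.toLinearMap_apply, LinearMap.mulRight_apply]
    rw [proj_of_mem _ k (mul_mem_grade (incl_mem_grade hb) (newGen_mem_grade m)),
      if_neg (by omega), LinearMap.zero_apply]
  exact LinearMap.congr_fun key b

variable {m : ℕ}

theorem newGen_mul_incl (h : DirectSum.IsInternal 𝒲) (hm : Odd m) (a : FreeCGA 𝒲) :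
    newGen 𝒲 m * incl 𝒲 m a = incl 𝒲 m (sgn h a) * newGen 𝒲 m := by
  rw [odd_mul (isInternal_extend h m) hm (newGen_mem_grade m), sgn_incl]

theorem newGen_mul_self (hm : Odd m) : newGen 𝒲 m * newGen 𝒲 m = 0 := by
  have h := mul_comm_of_mem (newGen_mem_grade (𝒲 := 𝒲) m) (newGen_mem_grade (𝒲 := 𝒲) m)
  rw [(hm.mul hm).neg_one_pow, neg_one_mul] at h
  have h2 : (2 : ℚ) • (newGen 𝒲 m * newGen 𝒲 m) = 0 := by
    rw [two_smul]; nth_rewrite 1 [h]; exact neg_add_cancel _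
  exact (smul_eq_zero.1 h2).resolve_left two_ne_zero

theorem pair_mul_pair (h : DirectSum.IsInternal 𝒲) (hm : Odd m) (a b a' b' : FreeCGA 𝒲) :
    pair 𝒲 m (a, b) * pair 𝒲 m (a', b') = pair 𝒲 m (a * a', a * b' + b * sgn h a') := by
  have h1 : incl 𝒲 m b * newGen 𝒲 m * incl 𝒲 m a' =
      incl 𝒲 m b * incl 𝒲 m (sgn h a') * newGen 𝒲 m := by
    rw [mul_assoc, newGen_mul_incl h hm, mul_assoc]
  have h2 : incl 𝒲 m b * newGen 𝒲 m * (incl 𝒲 m b' * newGen 𝒲 m) = 0 := by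
    rw [← mul_assoc, mul_assoc (incl 𝒲 m b), newGen_mul_incl h hm, ← mul_assoc, mul_assoc,
      newGen_mul_self hm, mul_zero]
  simp only [pair_apply, add_mul, mul_add, h1, h2, map_mul, map_add, mul_assoc]
  abel

theorem sgn_pair (h : DirectSum.IsInternal 𝒲) (hm : Odd m) (a b : FreeCGA 𝒲) :
    sgn (isInternal_extend h m) (pair 𝒲 m (a, b)) = pair 𝒲 m (sgn h a, -sgn h b) := by
  simp [pair_apply, sgn_incl h, sgn_of_mem _ (newGen_mem_grade (𝒲 := 𝒲) m), hm.neg_one_pow]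

theorem pair_surjective (h : DirectSum.IsInternal 𝒲) (hm : Odd m) :
    Function.Surjective (pair 𝒲 m) := by
  refine freeCGA_induction ?_ ?_ ?_ ?_
  · rintro ⟨w, t⟩
    exact ⟨(gen 𝒲 w, t • 1), by simp [pair_apply, gen_extend]⟩
  · intro c
    exact ⟨(c • 1, 0), by simp [pair_apply]⟩
  · rintro _ _ ⟨u, rfl⟩ ⟨v, rfl⟩
    exact ⟨u + v, map_add _ _ _⟩
  · rintro _ _ ⟨⟨a, b⟩, rfl⟩ ⟨⟨a', b'⟩, rfl⟩
    exact ⟨_, (pair_mul_pair h hm a b a' b').symm⟩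

/-- The generators of `ΛW ⊗ Λ(y)` as upper triangular matrices: `a + b y` is to act as
`!![a, b; 0, σ a]`, with `σ` the sign automorphism. -/
noncomputable def genMatrix (h : DirectSum.IsInternal 𝒲) :
    W × ℚ →ₗ[ℚ] Matrix (Fin 2) (Fin 2) (FreeCGA 𝒲) where
  toFun p := !![gen 𝒲 p.1, p.2 • 1; 0, sgn h (gen 𝒲 p.1)]
  map_add' p q := by
    ext i j; fin_cases i <;> fin_cases j <;> simp [add_smul]
  map_smul' c p := by
    ext i j; fin_cases i <;> fin_cases j <;> simp [mul_smul]

theorem genMatrix_apply (h : DirectSum.IsInternal 𝒲) (w : W) (t : ℚ) :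
    genMatrix h (w, t) = !![gen 𝒲 w, t • 1; 0, sgn h (gen 𝒲 w)] := rfl

theorem genMatrix_comm (h : DirectSum.IsInternal 𝒲) (hm : Odd m) (i j : ℕ) :
    ∀ p ∈ extend 𝒲 m i, ∀ q ∈ extend 𝒲 m j,
      genMatrix h p * genMatrix h q = (-1) ^ (i * j) * (genMatrix h q * genMatrix h p) := by
  rintro ⟨w, t⟩ ⟨hw, ht⟩ ⟨v, s⟩ ⟨hv, hs⟩
  have hsw := sgn_of_mem h (gen_mem_grade hw)
  have hsv := sgn_of_mem h (gen_mem_grade hv)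
  have hcomm := gen_mul_gen 𝒲 hw hv
  have e1 : s • gen 𝒲 w = (-1) ^ (i * j) * (s • sgn h (gen 𝒲 w)) := by
    by_cases hj : j = m
    · rw [hsw, mul_smul_comm, ← mul_assoc, ← pow_add]
      have : Even (i * j + i) := by
        rw [← Nat.mul_succ, hj]; exact (hm.add_one).mul_left i
      rw [this.neg_one_pow, one_mul]
    · have : s = 0 := by simpa [hj] using hs
      simp [this]
  have e2 : t • sgn h (gen 𝒲 v) = (-1) ^ (i * j) * (t • gen 𝒲 v) := by
    by_cases hi : i = m
    · rw [hsv, mul_smul_comm, hi, pow_mul, hm.neg_one_pow]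
    · have : t = 0 := by simpa [hi] using ht
      simp [this]
  have e3 : sgn h (gen 𝒲 w) * sgn h (gen 𝒲 v) =
      (-1) ^ (i * j) * (sgn h (gen 𝒲 v) * sgn h (gen 𝒲 w)) := by
    have := congrArg (sgn h) hcomm
    simpa using this
  rw [genMatrix_apply, genMatrix_apply]
  rcases Nat.even_or_odd (i * j) with e | e
  · simp only [e.neg_one_pow, one_mul] at hcomm e1 e2 e3 ⊢
    simp [hcomm, e1, e2, e3, add_comm]
  · simp only [e.neg_one_pow, neg_one_mul] at hcomm e1 e2 e3 ⊢
    simp [hcomm, e1, e2, e3, add_comm]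

/-- `a + b y` determines `a` and `b`: both can be read off from the matrix of `a + b y`. -/
theorem pair_injective (h : DirectSum.IsInternal 𝒲) (hm : Odd m) :
    Function.Injective (pair 𝒲 m) := by
  let T := lift (extend 𝒲 m) (genMatrix h) (genMatrix_comm h hm)
  have hT (w : W) (t : ℚ) : T (gen (extend 𝒲 m) (w, t)) = !![gen 𝒲 w, t • 1; 0, sgn h (gen 𝒲 w)] :=
    (lift_gen _ _ _ _).trans (genMatrix_apply h w t)
  have hincl (a : FreeCGA 𝒲) : T (incl 𝒲 m a) = !![a, 0; 0, sgn h a] := by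
    induction a using freeCGA_induction with
    | hgen w => rw [incl_gen, hT, zero_smul]
    | hscalar c =>
      rw [map_smul, map_one, map_smul, map_one, map_smul, map_one, Matrix.one_fin_two]
      simp
    | hadd a b ha hb => simp [ha, hb]
    | hmul a b ha hb => simp [ha, hb]
  rw [injective_iff_map_eq_zero]
  rintro ⟨a, b⟩ hab
  have e := congrArg T hab
  rw [pair_apply, map_add, map_mul, newGen, hT, hincl, hincl, Matrix.mul_fin_two] at e
  have e1 := congrFun (congrFun e 0) 0
  have e2 := congrFun (congrFun e 0) 1
  simp at e1 e2
  rw [e1, e2]; rfl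

theorem pair_mem_grade {j : ℕ} {a b : FreeCGA 𝒲} (ha : a ∈ grade 𝒲 (j + m))
    (hb : b ∈ grade 𝒲 j) : pair 𝒲 m (a, b) ∈ grade (extend 𝒲 m) (j + m) :=
  Submodule.add_mem _ (incl_mem_grade ha) (mul_mem_grade (incl_mem_grade hb) (newGen_mem_grade m))

theorem pair_zero_mem_grade {k : ℕ} {a : FreeCGA 𝒲} (ha : a ∈ grade 𝒲 k) :
    pair 𝒲 m (a, 0) ∈ grade (extend 𝒲 m) k := by
  simpa [pair_apply] using incl_mem_grade ha

theorem mem_grade_of_pair_mem (h : DirectSum.IsInternal 𝒲) (hm : Odd m) {j : ℕ}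
    {a b : FreeCGA 𝒲} (hab : pair 𝒲 m (a, b) ∈ grade (extend 𝒲 m) (j + m)) :
    a ∈ grade 𝒲 (j + m) ∧ b ∈ grade 𝒲 j := by
  have e := proj_same (isInternal_extend h m) hab
  rw [pair_apply, map_add, proj_incl h, proj_incl_mul_newGen h, ← pair_apply, ← pair_apply] at e
  have := Prod.ext_iff.1 (pair_injective h hm e)
  exact ⟨(mem_grade_iff_proj h).2 this.1, (mem_grade_iff_proj h).2 this.2⟩

theorem mem_grade_of_pair_mem_of_lt (h : DirectSum.IsInternal 𝒲) (hm : Odd m) {k : ℕ}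
    (hk : k < m) {a b : FreeCGA 𝒲} (hab : pair 𝒲 m (a, b) ∈ grade (extend 𝒲 m) k) :
    a ∈ grade 𝒲 k ∧ b = 0 := by
  have e := proj_same (isInternal_extend h m) hab
  have e0 : pair 𝒲 m (proj h k a, 0) = pair 𝒲 m (a, b) := by
    rw [← e]
    simp [pair_apply, proj_incl h, proj_incl_mul_newGen_of_lt h hk]
  have := Prod.ext_iff.1 (pair_injective h hm e0)
  exact ⟨(mem_grade_iff_proj h).2 this.1, this.2.symm⟩

/-! ### The differential with `d y = x` -/

/-- Every extension of `d` is given by `a + b y ↦ (d a + σ(b) x) + (d b) y`. -/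
theorem IsExtension.map_pair {d : Diff 𝒲} {x : FreeCGA 𝒲} {d' : Diff (extend 𝒲 m)}
    (hd' : IsExtension d m x d') (h : DirectSum.IsInternal 𝒲) (a b : FreeCGA 𝒲) :
    d'.map (pair 𝒲 m (a, b)) = pair 𝒲 m (d.map a + sgn h b * x, d.map b) := by
  have hincl (a : FreeCGA 𝒲) : d'.map (incl 𝒲 m a) = incl 𝒲 m (d.map a) := by
    induction a using freeCGA_induction with
    | hgen w => exact hd'.1 w
    | hscalar c => simp [Diff.map_one]
    | hadd a b ha hb => simp [ha, hb]
    | hmul a b ha hb =>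
      rw [map_mul, d'.map_mul (isInternal_extend h m), ha, hb, sgn_incl, d.map_mul h, map_add,
        map_mul, map_mul]
  simp only [pair_apply, map_add, hincl, d'.map_mul (isInternal_extend h m), hd'.2, sgn_incl h,
    map_mul]
  abel

theorem IsExtension.eq {d : Diff 𝒲} {x : FreeCGA 𝒲} {d₁ d₂ : Diff (extend 𝒲 m)}
    (h₁ : IsExtension d m x d₁) (h₂ : IsExtension d m x d₂) (h : DirectSum.IsInternal 𝒲)
    (hm : Odd m) : d₁ = d₂ := by
  refine Diff.ext_map (LinearMap.ext fun u => ?_)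
  obtain ⟨⟨a, b⟩, rfl⟩ := pair_surjective h hm u
  rw [h₁.map_pair h, h₂.map_pair h]

theorem exists_isExtension (d : Diff 𝒲) (h : DirectSum.IsInternal 𝒲) (hm : Odd m)
    {x : FreeCGA 𝒲} (hx : x ∈ cocycles d (m + 1)) :
    ∃ d' : Diff (extend 𝒲 m), IsExtension d m x d' := by
  obtain ⟨hxg, hdx⟩ := hx
  replace hdx : d.map x = 0 := hdx
  have hxc : ∀ b, x * b = b * x := even_mul h hm.add_one hxg
  have hsx : sgn h x = x := by rw [sgn_of_mem h hxg, hm.add_one.neg_one_pow, one_mul]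
  let e := LinearEquiv.ofBijective (pair 𝒲 m) ⟨pair_injective h hm, pair_surjective h hm⟩
  let D : FreeCGA 𝒲 × FreeCGA 𝒲 →ₗ[ℚ] FreeCGA 𝒲 × FreeCGA 𝒲 :=
    LinearMap.prod (LinearMap.coprod d.map (LinearMap.mulRight ℚ x ∘ₗ (sgn h).toLinearMap))
      (d.map ∘ₗ LinearMap.snd ℚ _ _)
  let δ : FreeCGA (extend 𝒲 m) →ₗ[ℚ] FreeCGA (extend 𝒲 m) :=
    pair 𝒲 m ∘ₗ D ∘ₗ e.symm.toLinearMap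
  have hδ (a b : FreeCGA 𝒲) :
      δ (pair 𝒲 m (a, b)) = pair 𝒲 m (d.map a + sgn h b * x, d.map b) := by
    have : e.symm (pair 𝒲 m (a, b)) = (a, b) := e.symm_apply_apply (a, b)
    simp only [δ, LinearMap.comp_apply, LinearEquiv.coe_coe, this]
    rfl
  refine ⟨⟨δ, ?_, ?_, ?_⟩, ?_, ?_⟩
  · intro k u hu
    obtain ⟨⟨a, b⟩, rfl⟩ := pair_surjective h hm u
    rw [hδ]
    rcases lt_or_ge k m with hk | hk
    · obtain ⟨ha, rfl⟩ := mem_grade_of_pair_mem_of_lt h hm hk hu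
      simpa using pair_zero_mem_grade (d.map_mem k a ha)
    · obtain ⟨j, rfl⟩ := Nat.exists_eq_add_of_le' hk
      obtain ⟨ha, hb⟩ := mem_grade_of_pair_mem h hm hu
      have hbx : sgn h b * x ∈ grade 𝒲 (j + 1 + m) := by
        have := mul_mem_grade (sgn_mem h hb) hxg
        rwa [show j + (m + 1) = j + 1 + m by omega] at this
      have hda := d.map_mem _ a ha
      rw [show j + m + 1 = j + 1 + m by omega] at hda ⊢
      exact pair_mem_grade (Submodule.add_mem _ hda hbx) (d.map_mem j b hb)
  · intro u
    obtain ⟨⟨a, b⟩, rfl⟩ := pair_surjective h hm u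
    rw [hδ, hδ, map_add, d.map_map, d.map_map, d.map_mul h, hdx, d.sgn_map h]
    simp [pair_apply]
  · intro k u hu v
    obtain ⟨⟨a, b⟩, rfl⟩ := pair_surjective h hm u
    obtain ⟨⟨a', b'⟩, rfl⟩ := pair_surjective h hm v
    rw [← mul_assoc, ← sgn_of_mem (isInternal_extend h m) hu, sgn_pair h hm,
      pair_mul_pair h hm, hδ, hδ, hδ, pair_mul_pair h hm, pair_mul_pair h hm, ← map_add]
    refine congrArg _ (Prod.ext ?_ ?_)
    · simp only [Prod.fst_add, map_add, map_mul, sgn_sgn, d.map_mul h, add_mul, mul_add, mul_assoc,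
        hxc]
      abel
    · simp only [Prod.snd_add, map_add, map_mul, sgn_sgn, d.map_mul h, d.sgn_map h, add_mul,
        mul_add, mul_assoc, neg_mul, mul_neg, hxc, hsx]
      abel
  · intro w
    have := hδ (gen 𝒲 w) 0
    simpa [pair_apply] using this
  · have := hδ 0 1
    simpa [pair_apply, d.map_one] using this

end Extension

/-! ### The cohomology of the extension -/

section ExtensionCohomology

variable {W : Type*} [AddCommGroup W] [Module ℚ W] {𝒲 : ℕ → Submodule ℚ W} {d : Diff 𝒲}
  {m : ℕ} {x : FreeCGA 𝒲} {d' : Diff (extend 𝒲 m)}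

theorem IsExtension.pair_mem_cocycles_iff (hd' : IsExtension d m x d')
    (h : DirectSum.IsInternal 𝒲) (hm : Odd m) {j : ℕ} {a b : FreeCGA 𝒲} :
    pair 𝒲 m (a, b) ∈ cocycles d' (j + m) ↔
      a ∈ grade 𝒲 (j + m) ∧ b ∈ cocycles d j ∧ d.map a + sgn h b * x = 0 := by
  have key : d'.map (pair 𝒲 m (a, b)) = 0 ↔ d.map a + sgn h b * x = 0 ∧ d.map b = 0 := by
    rw [hd'.map_pair h, ← (pair 𝒲 m).map_zero, (pair_injective h hm).eq_iff, Prod.ext_iff]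
    rfl
  constructor
  · rintro ⟨hg, hker⟩
    obtain ⟨ha, hb⟩ := mem_grade_of_pair_mem h hm hg
    obtain ⟨h1, h2⟩ := key.1 hker
    exact ⟨ha, ⟨hb, h2⟩, h1⟩
  · rintro ⟨ha, hb, h1⟩
    exact ⟨pair_mem_grade ha hb.1, key.2 ⟨h1, hb.2⟩⟩

theorem IsExtension.pair_zero_mem_cocycles (hd' : IsExtension d m x d')
    (h : DirectSum.IsInternal 𝒲) {k : ℕ} {a : FreeCGA 𝒲} (ha : a ∈ cocycles d k) :
    pair 𝒲 m (a, 0) ∈ cocycles d' k := by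
  have hda : d.map a = 0 := ha.2
  refine ⟨pair_zero_mem_grade ha.1, LinearMap.mem_ker.2 ?_⟩
  rw [hd'.map_pair h]
  simp [hda, pair_apply]

theorem IsExtension.pair_zero_mem_coboundaries (hd' : IsExtension d m x d')
    (h : DirectSum.IsInternal 𝒲) {k : ℕ} {a : FreeCGA 𝒲} (ha : a ∈ coboundaries d k) :
    pair 𝒲 m (a, 0) ∈ coboundaries d' k := by
  obtain ⟨hg, c, rfl⟩ := ha
  exact ⟨pair_zero_mem_grade hg, pair 𝒲 m (c, 0), by rw [hd'.map_pair h]; simp⟩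

/-- From the degree of `x` on, the only cohomology is spanned by the class of `x`, which the
extension kills. -/
theorem exists_eq_smul_add_map (hvan : ∀ k, m + 1 < k → cocycles d k ≤ coboundaries d k)
    (hx : RepresentsFundamentalClass d (m + 1) x) {k : ℕ} (hk : m + 1 ≤ k) {a : FreeCGA 𝒲}
    (ha : a ∈ cocycles d k) : ∃ (r : ℚ) (c : FreeCGA 𝒲), a = r • x + d.map c := by
  rcases hk.eq_or_lt with rfl | hk
  · obtain ⟨r, -, c, hc⟩ := ((representsFundamentalClass_iff d).1 hx).2.2 a ha
    exact ⟨r, c, by rw [hc]; abel⟩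
  · obtain ⟨-, c, hc⟩ := hvan k hk ha
    exact ⟨0, c, by rw [hc, zero_smul, zero_add]⟩

/-- Above degree `m` the class of a cocycle `a + b y` vanishes if and only if that of `b` does. -/
theorem IsExtension.pair_mem_coboundaries_iff (hd' : IsExtension d m x d')
    (h : DirectSum.IsInternal 𝒲) (hm : Odd m)
    (hvan : ∀ k, m + 1 < k → cocycles d k ≤ coboundaries d k)
    (hx : RepresentsFundamentalClass d (m + 1) x) {j : ℕ} (hj : 0 < j) {a b : FreeCGA 𝒲}
    (hab : pair 𝒲 m (a, b) ∈ cocycles d' (j + m)) :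
    pair 𝒲 m (a, b) ∈ coboundaries d' (j + m) ↔ b ∈ coboundaries d j := by
  obtain ⟨ha, hb, hd⟩ := (hd'.pair_mem_cocycles_iff h hm).1 hab
  obtain ⟨⟨hxg, hdx⟩, -⟩ := (representsFundamentalClass_iff d).1 hx
  replace hdx : d.map x = 0 := hdx
  constructor
  · rintro ⟨-, u, hu⟩
    obtain ⟨⟨e, f⟩, rfl⟩ := pair_surjective h hm u
    rw [hd'.map_pair h] at hu
    exact ⟨hb.1, f, (Prod.ext_iff.1 (pair_injective h hm hu)).2⟩
  · intro hbc
    obtain ⟨i, rfl⟩ := Nat.exists_eq_succ_of_ne_zero hj.ne'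
    obtain ⟨f, hf, rfl⟩ := d.exists_mem_map_eq h hbc
    -- Subtracting the boundary of `f y` leaves a cocycle of `ΛW`, of degree at least `m + 1`.
    have hcoc : a - sgn h f * x ∈ cocycles d (i + 1 + m) := by
      refine ⟨Submodule.sub_mem _ ha ?_, LinearMap.mem_ker.2 ?_⟩
      · have := mul_mem_grade (sgn_mem h hf) hxg
        rwa [show i + (m + 1) = i + 1 + m by omega] at this
      · rw [map_sub, d.map_mul h, hdx, mul_zero, add_zero, sub_eq_add_neg, ← neg_mul,
          ← d.sgn_map h, hd]
    obtain ⟨r, c, hrc⟩ := exists_eq_smul_add_map hvan hx (by omega) hcoc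
    refine ⟨hab.1, pair 𝒲 m (c, f + r • 1), ?_⟩
    rw [hd'.map_pair h]
    refine congrArg _ (Prod.ext ?_ ?_)
    · rw [sub_eq_iff_eq_add] at hrc
      simp only [hrc, map_add, map_smul, map_one, add_mul, smul_mul_assoc, one_mul]
      abel
    · simp [d.map_one]

theorem IsExtension.exists_pair_mem_cocycles (hd' : IsExtension d m x d')
    (h : DirectSum.IsInternal 𝒲) (hm : Odd m)
    (hvan : ∀ k, m + 1 < k → cocycles d k ≤ coboundaries d k)
    (hx : x ∈ cocycles d (m + 1)) {j : ℕ} (hj : 0 < j) {b : FreeCGA 𝒲}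
    (hb : b ∈ cocycles d j) : ∃ a, pair 𝒲 m (a, b) ∈ cocycles d' (j + m) := by
  have hsb : sgn h b ∈ cocycles d j := by
    have hdb : d.map b = 0 := hb.2
    refine ⟨sgn_mem h hb.1, LinearMap.mem_ker.2 ?_⟩
    rw [← neg_eq_zero, ← d.sgn_map h, hdb, map_zero]
  have hmem := hvan _ (by omega) (mul_mem_cocycles d hsb hx)
  obtain ⟨c, hc, hdc⟩ := d.exists_mem_map_eq h (k := j + m) hmem
  refine ⟨-c, (hd'.pair_mem_cocycles_iff h hm).2 ⟨Submodule.neg_mem _ hc, hb, ?_⟩⟩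
  rw [map_neg, hdc, neg_add_cancel]

/-- Up to degree `m` the extension has no new cocycles: in degree `m` because `x` is not exact. -/
theorem IsExtension.exists_eq_of_mem_cocycles (hd' : IsExtension d m x d')
    (h : DirectSum.IsInternal 𝒲) (hm : Odd m) (h0 : 𝒲 0 = ⊥)
    (hx : RepresentsFundamentalClass d (m + 1) x) {k : ℕ} (hk : k ≤ m)
    {u : FreeCGA (extend 𝒲 m)} (hu : u ∈ cocycles d' k) :
    ∃ a ∈ cocycles d k, u = pair 𝒲 m (a, 0) := by
  obtain ⟨⟨a, b⟩, rfl⟩ := pair_surjective h hm u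
  obtain ⟨⟨hxg, -⟩, hx0, -⟩ := (representsFundamentalClass_iff d).1 hx
  have hb : b = 0 := by
    rcases hk.eq_or_lt with rfl | hk
    · have hu' : pair 𝒲 k (a, b) ∈ cocycles d' (0 + k) := by rw [zero_add]; exact hu
      obtain ⟨-, hb, hd⟩ := (hd'.pair_mem_cocycles_iff h hm).1 hu'
      obtain ⟨r, rfl⟩ := grade_zero_le h0 hb.1
      rw [map_smul, map_one, smul_mul_assoc, one_mul] at hd
      by_contra hr
      have hr0 : r ≠ 0 := fun e => hr (by rw [e, zero_smul])
      refine hx0 ⟨hxg, -(r⁻¹ • a), ?_⟩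
      rw [map_neg, map_smul, eq_neg_of_add_eq_zero_left hd, smul_neg, neg_neg, smul_smul,
        inv_mul_cancel₀ hr0, one_smul]
    · exact (mem_grade_of_pair_mem_of_lt h hm hk hu.1).2
  subst hb
  have hda : d.map a = 0 := by
    have : d'.map (pair 𝒲 m (a, 0)) = pair 𝒲 m (0, 0) := by
      rw [LinearMap.mem_ker.1 hu.2]; simp [pair_apply]
    rw [hd'.map_pair h] at this
    simpa using (Prod.ext_iff.1 (pair_injective h hm this)).1
  refine ⟨a, ⟨?_, hda⟩, rfl⟩
  have := proj_same (isInternal_extend h m) hu.1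
  rw [pair_apply, map_zero, zero_mul, add_zero, proj_incl h] at this
  have e : pair 𝒲 m (proj h k a, 0) = pair 𝒲 m (a, 0) := by simpa [pair_apply] using this
  exact (mem_grade_iff_proj h).2 (Prod.ext_iff.1 (pair_injective h hm e)).1

theorem IsExtension.subsingleton_cohomology (hd' : IsExtension d m x d')
    (h : DirectSum.IsInternal 𝒲) (hm : Odd m)
    (hvan : ∀ k, m + 1 < k → cocycles d k ≤ coboundaries d k)
    (hx : RepresentsFundamentalClass d (m + 1) x) {k : ℕ} (hk : m + 1 + m < k) :
    Subsingleton (Cohomology d' k) := by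
  obtain ⟨j, rfl⟩ := Nat.exists_eq_add_of_le' (show m ≤ k by omega)
  rw [subsingleton_cohomology_iff]
  intro u hu
  obtain ⟨⟨a, b⟩, rfl⟩ := pair_surjective h hm u
  rw [hd'.pair_mem_coboundaries_iff h hm hvan hx (by omega) hu]
  exact hvan j (by omega) ((hd'.pair_mem_cocycles_iff h hm).1 hu).2.1

theorem IsExtension.representsFundamentalClass (hd' : IsExtension d m x d')
    (h : DirectSum.IsInternal 𝒲) (hm : Odd m)
    (hvan : ∀ k, m + 1 < k → cocycles d k ≤ coboundaries d k)
    (hx : RepresentsFundamentalClass d (m + 1) x) {z : FreeCGA 𝒲}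
    (hz : z ∈ grade 𝒲 (m + 1 + m)) (hdz : d.map z = x ^ 2) :
    RepresentsFundamentalClass d' (m + 1 + m) (incl 𝒲 m x * newGen 𝒲 m - incl 𝒲 m z) := by
  obtain ⟨hxc, hx0, hxs⟩ := (representsFundamentalClass_iff d).1 hx
  have hsx : sgn h x = x := by rw [sgn_of_mem h hxc.1, hm.add_one.neg_one_pow, one_mul]
  have hp : incl 𝒲 m x * newGen 𝒲 m - incl 𝒲 m z = pair 𝒲 m (-z, x) := by
    rw [pair_apply, map_neg]; abel
  have hc : pair 𝒲 m (-z, x) ∈ cocycles d' (m + 1 + m) :=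
    (hd'.pair_mem_cocycles_iff h hm).2
      ⟨Submodule.neg_mem _ hz, hxc, by rw [map_neg, hdz, hsx, sq, neg_add_cancel]⟩
  rw [hp, representsFundamentalClass_iff]
  refine ⟨hc, fun hb => hx0 ?_, fun u hu => ?_⟩
  · exact (hd'.pair_mem_coboundaries_iff h hm hvan hx (by omega) hc).1 hb
  · obtain ⟨⟨a, b⟩, rfl⟩ := pair_surjective h hm u
    obtain ⟨r, hr⟩ := hxs b ((hd'.pair_mem_cocycles_iff h hm).1 hu).2.1
    refine ⟨r, ?_⟩
    have hsub := Submodule.sub_mem _ hu (Submodule.smul_mem _ r hc)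
    rw [← map_smul, ← map_sub] at hsub ⊢
    exact (hd'.pair_mem_coboundaries_iff h hm hvan hx (by omega) hsub).2 hr

/-- Poincaré duality passes to the extension. A class of degree at most `m` comes from `ΛW` and is
paired with a class `c + e y`; a class `a + b y` of higher degree is paired with one from `ΛW`. In
both cases the `y`-part of the product is a product in the cohomology of `ΛW`. -/
theorem IsExtension.exists_mul_notMem_coboundaries (hd' : IsExtension d m x d')
    (h : DirectSum.IsInternal 𝒲) (hm : Odd m) (h0 : 𝒲 0 = ⊥)
    (hvan : ∀ k, m + 1 < k → cocycles d k ≤ coboundaries d k)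
    (hx : RepresentsFundamentalClass d (m + 1) x)
    (hpd : ∀ i j, i + j = m + 1 → ∀ a ∈ cocycles d i, a ∉ coboundaries d i →
      ∃ b ∈ cocycles d j, a * b ∉ coboundaries d (m + 1)) {i j : ℕ} (hij : i + j = m + 1 + m)
    {u : FreeCGA (extend 𝒲 m)} (hu : u ∈ cocycles d' i) (hu0 : u ∉ coboundaries d' i) :
    ∃ v ∈ cocycles d' j, u * v ∉ coboundaries d' (m + 1 + m) := by
  have hxc := ((representsFundamentalClass_iff d).1 hx).1
  -- A product is nonzero in the top degree as soon as its `y`-part is.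
  have key {a b a' b' : FreeCGA 𝒲} (hab : pair 𝒲 m (a, b) ∈ cocycles d' i)
      (hab' : pair 𝒲 m (a', b') ∈ cocycles d' j)
      (hne : a * b' + b * sgn h a' ∉ coboundaries d (m + 1)) :
      pair 𝒲 m (a, b) * pair 𝒲 m (a', b') ∉ coboundaries d' (m + 1 + m) := by
    have hmul := mul_mem_cocycles d' hab hab'
    rw [pair_mul_pair h hm, hij] at hmul
    rw [pair_mul_pair h hm]
    rwa [hd'.pair_mem_coboundaries_iff h hm hvan hx (by omega) hmul]
  rcases le_or_gt i m with hi | hi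
  · obtain ⟨a, ha, rfl⟩ := hd'.exists_eq_of_mem_cocycles h hm h0 hx hi hu
    obtain ⟨j', rfl⟩ := Nat.exists_eq_add_of_le' (show m ≤ j by omega)
    obtain ⟨e, he, hae⟩ := hpd i j' (by omega) a ha
      fun hb => hu0 (hd'.pair_zero_mem_coboundaries h hb)
    obtain ⟨c, hc⟩ := hd'.exists_pair_mem_cocycles h hm hvan hxc (by omega) he
    exact ⟨_, hc, key hu hc (by simpa using hae)⟩
  · obtain ⟨i', rfl⟩ := Nat.exists_eq_add_of_le' hi.le
    obtain ⟨⟨a, b⟩, rfl⟩ := pair_surjective h hm u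
    rw [hd'.pair_mem_coboundaries_iff h hm hvan hx (by omega) hu] at hu0
    obtain ⟨e, he, hbe⟩ := hpd i' j (by omega) b
      ((hd'.pair_mem_cocycles_iff h hm).1 hu).2.1 hu0
    have hc := hd'.pair_zero_mem_cocycles h he
    refine ⟨_, hc, key hu hc ?_⟩
    rw [mul_zero, zero_add, sgn_of_mem h he.1]
    rcases neg_one_pow_eq_or (FreeCGA 𝒲) j with e' | e' <;> simpa [e'] using hbe

end ExtensionCohomology

/-! ### The Sullivan conditions for the extension -/

section ExtensionSullivan

variable {W : Type*} [AddCommGroup W] [Module ℚ W] {𝒲 : ℕ → Submodule ℚ W} {d : Diff 𝒲}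
  {m : ℕ} {x : FreeCGA 𝒲} {d' : Diff (extend 𝒲 m)}

theorem incl_mem_subFree {V : Set W} {V' : Set (W × ℚ)} (hV : ∀ v ∈ V, (v, (0 : ℚ)) ∈ V')
    {a : FreeCGA 𝒲} (ha : a ∈ subFree 𝒲 V) : incl 𝒲 m a ∈ subFree (extend 𝒲 m) V' := by
  have hmap : incl 𝒲 m a ∈ (subFree 𝒲 V).map (incl 𝒲 m) := ⟨a, ha, rfl⟩
  rw [subFree, AlgHom.map_adjoin] at hmap
  refine Algebra.adjoin_mono ?_ hmap
  rintro _ ⟨_, ⟨v, hv, rfl⟩, rfl⟩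
  exact ⟨(v, 0), hV v hv, (incl_gen 𝒲 m v).symm⟩

theorem subFree_univ : subFree 𝒲 (Set.univ : Set W) = ⊤ := by
  rw [subFree, Set.image_univ, adjoin_range_gen]

theorem IsExtension.map_gen (hd' : IsExtension d m x d') (w : W) (t : ℚ) :
    d'.map (gen (extend 𝒲 m) (w, t)) = incl 𝒲 m (d.map (gen 𝒲 w)) + t • incl 𝒲 m x := by
  rw [gen_extend, map_add, map_smul, hd'.1, hd'.2]

theorem extend_zero (h0 : 𝒲 0 = ⊥) (hm : m ≠ 0) : extend 𝒲 m 0 = ⊥ := by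
  rw [extend, h0, if_neg hm.symm, Submodule.prod_bot]

theorem prod_eq_iSup_inf_extend {F : Submodule ℚ W} (hF : F = ⨆ i, F ⊓ 𝒲 i) (m : ℕ)
    (P : Submodule ℚ ℚ) : F.prod P = ⨆ i, F.prod P ⊓ extend 𝒲 m i := by
  refine le_antisymm ?_ (iSup_le fun i => inf_le_left)
  rintro ⟨w, t⟩ ⟨hw, ht⟩
  have h1 : (w, (0 : ℚ)) ∈ ⨆ i, F.prod P ⊓ extend 𝒲 m i := by
    have hle : ⨆ i, F ⊓ 𝒲 i ≤ (⨆ i, F.prod P ⊓ extend 𝒲 m i).comap (LinearMap.inl ℚ W ℚ) :=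
      iSup_le fun i v hv => Submodule.mem_iSup_of_mem i
        ⟨⟨hv.1, Submodule.zero_mem _⟩, ⟨hv.2, Submodule.zero_mem _⟩⟩
    exact hle (hF ▸ hw)
  have h2 : ((0 : W), t) ∈ ⨆ i, F.prod P ⊓ extend 𝒲 m i :=
    Submodule.mem_iSup_of_mem m
      ⟨⟨Submodule.zero_mem _, ht⟩, ⟨Submodule.zero_mem _, by simp⟩⟩
  simpa using Submodule.add_mem _ h1 h2

theorem IsExtension.isSullivan [FiniteDimensional ℚ W] (hd' : IsExtension d m x d')
    (hS : IsSullivan d) (hm : m ≠ 0) : IsSullivan d' := by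
  obtain ⟨F, hmono, hsup, hgr, hF0, hFs⟩ := hS.exists_filtration
  -- The filtration is stationary, so that `y` can be added once it has reached `W`.
  obtain ⟨n, hn⟩ := monotone_stabilizes_iff_noetherian.2
    (inferInstance : IsNoetherian ℚ W) ⟨F, hmono⟩
  replace hn : ∀ k, n ≤ k → F n = F k := hn
  have hFtop : ∀ k, n ≤ k → F k = ⊤ := by
    intro k hk
    rw [← hn k hk, eq_top_iff, ← hsup]
    refine iSup_le fun i => ?_
    rcases le_total i n with hi | hi
    · exact hmono hi
    · exact (hn i hi).ge
  let P : ℕ → Submodule ℚ ℚ := fun k => if n < k then ⊤ else ⊥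
  have hP : Monotone P := by
    intro i j hij
    by_cases hi : n < i
    · simp [P, hi, hi.trans_le hij]
    · simp [P, hi]
  refine ⟨isInternal_extend hS.isInternal m, fun k => inferInstance,
    extend_zero hS.degree_zero hm, fun k => (F k).prod (P k), ?_, ?_, ?_, ?_, ?_⟩
  · exact fun i j hij => Submodule.prod_mono (hmono hij) (hP hij)
  · rw [eq_top_iff]
    refine le_trans ?_ (le_iSup _ (n + 1))
    simp [hFtop (n + 1) (by omega), P]
  · exact fun k => prod_eq_iSup_inf_extend (hgr k) m (P k)
  · rintro ⟨w, t⟩ ⟨hw, ht⟩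
    have ht0 : t = 0 := by simpa [P] using ht
    rw [hd'.map_gen, hF0 w hw, ht0, map_zero, zero_smul, add_zero]
  · rintro k ⟨w, t⟩ ⟨hw, ht⟩
    rw [hd'.map_gen]
    have hV : ∀ v ∈ (F k : Set W), (v, (0 : ℚ)) ∈ ((F k).prod (P k) : Set (W × ℚ)) :=
      fun v hv => ⟨hv, Submodule.zero_mem _⟩
    refine Subalgebra.add_mem _ (incl_mem_subFree hV (hFs k w hw)) ?_
    by_cases hk : n < k + 1
    · refine Subalgebra.smul_mem _ (incl_mem_subFree hV ?_) t
      rw [hFtop k (by omega), Submodule.top_coe, subFree_univ]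
      exact Algebra.mem_top
    · have ht0 : t = 0 := by simpa [P, hk] using ht
      rw [ht0, zero_smul]
      exact Subalgebra.zero_mem _

theorem IsExtension.isDegreeSullivan [FiniteDimensional ℚ W] (hd' : IsExtension d m x d')
    (hS : IsDegreeSullivan d)    (hm0 : m ≠ 0) (hm1 : m ≠ 1) (hx : x ∈ subFree 𝒲 {v | ∃ s < m, v ∈ 𝒲 s}) :
    IsDegreeSullivan d' := by
  have hV (r : ℕ) : ∀ v ∈ {v | ∃ s < r, v ∈ 𝒲 s},
      (v, (0 : ℚ)) ∈ {v | ∃ s < r, v ∈ extend 𝒲 m s} := by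
    rintro v ⟨s, hs, hv⟩
    exact ⟨s, hs, hv, Submodule.zero_mem _⟩
  refine ⟨isInternal_extend hS.isInternal m, fun k => inferInstance,
    extend_zero hS.degree_zero hm0, ?_, ?_⟩
  · rw [extend, hS.degree_one, if_neg hm1.symm, Submodule.prod_bot]
  · rintro r ⟨w, t⟩ ⟨hw, ht⟩
    rw [hd'.map_gen]
    refine Subalgebra.add_mem _ (incl_mem_subFree (hV r) (hS.map_mem_lower r w hw)) ?_
    by_cases hr : r = m
    · exact Subalgebra.smul_mem _ (incl_mem_subFree (hV r) (hr ▸ hx)) t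
    · have ht0 : t = 0 := by simpa [hr] using ht
      rw [ht0, zero_smul]
      exact Subalgebra.zero_mem _

end ExtensionSullivan

end SullivanModel

theorem mainTheorem9 {W : Type*} [AddCommGroup W] [Module ℚ W] (𝒲 : ℕ → Submodule ℚ W)
    (d : SullivanModel.Diff 𝒲) (hS : SullivanModel.IsSullivan d)
    (hE : SullivanModel.IsElliptic d) (n : ℕ) (hn : 0 < n)
    (hfd : SullivanModel.HasFormalDimension d (2 * n)) (x : SullivanModel.FreeCGA 𝒲)
    (hx : SullivanModel.RepresentsFundamentalClass d (2 * n) x) :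
    (∃! d' : SullivanModel.Diff (SullivanModel.extend 𝒲 (2 * n - 1)),
      SullivanModel.IsExtension d (2 * n - 1) x d') ∧
    (∃ z ∈ SullivanModel.grade 𝒲 (4 * n - 1), d.map z = x ^ 2) ∧
    ∀ d' : SullivanModel.Diff (SullivanModel.extend 𝒲 (2 * n - 1)),
      SullivanModel.IsExtension d (2 * n - 1) x d' →
        SullivanModel.IsSullivan d' ∧
        (SullivanModel.IsDegreeSullivan d →
          x ∈ SullivanModel.subFree 𝒲 {v | ∃ s < 2 * n - 1, v ∈ 𝒲 s} →
            SullivanModel.IsDegreeSullivan d') ∧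
        SullivanModel.IsElliptic d' ∧
        SullivanModel.HasFormalDimension d' (4 * n - 1) ∧
        (SullivanModel.HasPoincareDuality d (2 * n) →
          SullivanModel.HasPoincareDuality d' (4 * n - 1)) ∧
        ∀ z ∈ SullivanModel.grade 𝒲 (4 * n - 1), d.map z = x ^ 2 →
          SullivanModel.RepresentsFundamentalClass d' (4 * n - 1)
            (SullivanModel.incl 𝒲 (2 * n - 1) x * SullivanModel.newGen 𝒲 (2 * n - 1) -
              SullivanModel.incl 𝒲 (2 * n - 1) z) := by
  open SullivanModel in
  obtain ⟨m, hm⟩ : ∃ m, m = 2 * n - 1 := ⟨_, rfl⟩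
  have h2n : 2 * n = m + 1 := by omega
  have h4n : 4 * n - 1 = m + 1 + m := by omega
  have hodd : Odd m := ⟨n - 1, by omega⟩
  rw [← hm, h4n]
  rw [h2n] at hfd hx ⊢
  have hI := hS.isInternal
  have h0 := hS.degree_zero
  have hW := hE.1
  have hvan : ∀ k, m + 1 < k → cocycles d k ≤ coboundaries d k := fun k hk =>
    (subsingleton_cohomology_iff d k).1 (hfd.2 k hk)
  obtain ⟨hxc, hx0, -⟩ := (representsFundamentalClass_iff d).1 hx
  obtain ⟨z, hz, hdz⟩ : ∃ z ∈ grade 𝒲 (m + 1 + m), d.map z = x ^ 2 := by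
    have hxx := hvan _ (by omega) (mul_mem_cocycles d hxc hxc)
    rw [← add_assoc, ← sq] at hxx
    exact d.exists_mem_map_eq hI hxx
  refine ⟨?_, ⟨z, hz, hdz⟩, fun d' hd' => ?_⟩
  · obtain ⟨d', hd'⟩ := exists_isExtension d hI hodd hxc
    exact ⟨d', hd', fun d₂ h₂ => h₂.eq hd' hI hodd⟩
  have hS' := hd'.isSullivan hS hodd.pos.ne'
  have hsub : ∀ k, m + 1 + m < k → Subsingleton (Cohomology d' k) := fun k hk =>
    hd'.subsingleton_cohomology hI hodd hvan hx hk
  have hfin := finite_cohomology d' hS'.degree_zero hsub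
  have hrep : ∀ z ∈ grade 𝒲 (m + 1 + m), d.map z = x ^ 2 →
      RepresentsFundamentalClass d' (m + 1 + m) (incl 𝒲 m x * newGen 𝒲 m - incl 𝒲 m z) :=
    fun z hz hdz => hd'.representsFundamentalClass hI hodd hvan hx hz hdz
  have hfd' : HasFormalDimension d' (m + 1 + m) :=
    ⟨finrank_cohomology_eq_one d' (hrep z hz hdz), hsub⟩
  refine ⟨hS', fun hD hxs => ?_, ⟨inferInstance, hfin⟩, hfd', fun hpd => ⟨hfin, hfd', ?_⟩, hrep⟩
  · refine hd'.isDegreeSullivan hD hodd.pos.ne' ?_ hxs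
    -- If `m = 1` then `x` would be a scalar, hence zero for reasons of degree.
    rintro rfl
    have hempty : gen 𝒲 '' {v | ∃ s < 1, v ∈ 𝒲 s} ⊆ {0} := by
      rintro _ ⟨v, ⟨s, hs, hv⟩, rfl⟩
      rw [Nat.lt_one_iff.1 hs, h0, Submodule.mem_bot] at hv
      simp [hv]
    have hbot : x ∈ (⊥ : Subalgebra ℚ (FreeCGA 𝒲)) := by
      have := Algebra.adjoin_mono hempty hxs
      simpa using this
    obtain ⟨c, rfl⟩ := Algebra.mem_bot.1 hbot
    refine hx0 ?_
    have hc : algebraMap ℚ (FreeCGA 𝒲) c ∈ grade 𝒲 0 := by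
      rw [Algebra.algebraMap_eq_smul_one]
      exact Submodule.smul_mem _ _ one_mem_grade
    have hc0 := proj_same hI hxc.1
    rw [proj_of_mem hI _ hc] at hc0
    rw [← hc0]
    simp
  · intro i j hij u hu hu0
    exact hd'.exists_mul_notMem_coboundaries hI hodd h0 hvan hx hpd.2.2 hij hu hu0
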